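/- Let $B$ be a (possibly nonunital) $C^*$-algebra and let $D$ be a hereditary subalgebra of $B$, i.e. a norm-closed $*$-subalgebra of $B$ such that $b \in B$, $d \in D$ and $0 \le b \le d$ imply $b \in D$. Let $L = \overline{BD}$, the closed linear span of the products $bd$ with $b \in B$, $d \in D$, be the left ideal of $B$ associated with $D$, let $L^* = \{a^* : a \in L\}$, and let $L + L^* = \{a + c : a \in L,\ c \in L^*\}$. Then $D$ is proximinal in $L + L^*$: $D \subseteq L + L^*$, and for every $x \in L + L^*$ there exists a (not necessarily unique) $y \in D$ with $$\|x - y\| = \min_{z \in D} \|x - z\| .$$ -/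

import Mathlib

/-- A hereditary (C⋆-)subalgebra of a C⋆-algebra `B`: a norm-closed ⋆-subalgebra `D` such that
`0 ≤ b ≤ d` with `b ∈ B`, `d ∈ D` forces `b ∈ D`. -/
structure IsHereditarySubalgebra {B : Type*} [NonUnitalCStarAlgebra B] [PartialOrder B]
    (D : NonUnitalStarSubalgebra ℂ B) : Prop where
  isClosed : IsClosed (D : Set B)
  hereditary : ∀ ⦃b d : B⦄, d ∈ D → 0 ≤ b → b ≤ d → b ∈ D

/-- The left ideal associated with `D`: the closed linear span of the products `b * d` with
`b ∈ B` and `d ∈ D`. -/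
def associatedLeftIdeal {B : Type*} [NonUnitalCStarAlgebra B]
    (D : NonUnitalStarSubalgebra ℂ B) : Submodule ℂ B :=
  (Submodule.span ℂ {x : B | ∃ b : B, ∃ d ∈ D, x = b * d}).topologicalClosure

/-- The adjoint `L⋆ = {star a | a ∈ L}` of a linear subspace `L`. -/
def adjointSubspace {B : Type*} [NonUnitalCStarAlgebra B] (L : Submodule ℂ B) :
    Submodule ℂ B where
  carrier := {x : B | star x ∈ L}
  add_mem' := by
    intro a b ha hb
    simpa only [Set.mem_ofPred_eq, star_add] using L.add_mem ha hb
  zero_mem' := by simp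
  smul_mem' := by
    intro c a ha
    simpa only [Set.mem_ofPred_eq, star_smul] using L.smul_mem (star c) ha

/-- The linear subspace `E` is proximinal in the linear subspace `X`: it is contained in `X`, and
every `x ∈ X` has a (not necessarily unique) closest point in `E`. -/
def IsProximinalIn {V : Type*} [NormedAddCommGroup V] [Module ℂ V] (E X : Submodule ℂ V) : Prop :=
  E ≤ X ∧ ∀ x ∈ X, ∃ y ∈ E, ∀ z ∈ E, ‖x - y‖ ≤ ‖x - z‖

/-! A best approximation is built by successive correction: if `dist(x, D)² = q` and `‖x‖² < q + ε`,
some `y ∈ D` has `‖y‖ ≤ 2√ε` and `‖x - y‖² < q + ε/2` (`exists_mem_norm_sub_sq_lt`). Since `x - y`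
lies again in `L + L⋆`, at the same distance from `D`, iteration with `ε = 2⁻ⁿ` gives a convergent
series.

For one correction, take `k` far along an approximate unit of `D`, put `s = √(1 - k²)` in the
unitization, and view `x` as the 2×2 matrix with entries `kxk`, `kxs`, `sxk`, `sxs`. The last is
small because `x ∈ L + L⋆`. The off-diagonal ones have squared norm at most `q + ε/8`, because `zs`
and `sz` are small for a near-optimal `z ∈ D`. A quantitative Parrott-type completion
(`exists_corner_correction`) then lowers the norm by a small change `w` of the corner `kxk` alone,
and heredity puts `kwk` in `D`. -/

section Unital

/-! ### Resolvents and 2×2 matrix completion -/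

variable {A : Type*} [CStarAlgebra A] [PartialOrder A] [StarOrderedRing A]

theorem exists_resolvent {N : A} (hN : IsSelfAdjoint N) {r T : ℝ} (hr : N ≤ r • (1 : A))
    (hrT : r < T) :
    ∃ S : A, 0 ≤ S ∧ S * N = T • S - 1 ∧ N * S = T • S - 1 ∧ (T - r) • S ≤ 1 := by
  have hτ : 0 < T - r := sub_pos.2 hrT
  have hle : algebraMap ℝ A (T - r) ≤ T • (1 : A) - N := by
    rw [Algebra.algebraMap_eq_smul_one, sub_smul]
    exact sub_le_sub_left hr _
  have hsa : IsSelfAdjoint (T • (1 : A) - N) := ((IsSelfAdjoint.all T).smul (.one A)).sub hN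
  have hτ0 : 0 ≤ algebraMap ℝ A (T - r) := algebraMap_nonneg A hτ.le
  have hu : IsUnit (T • (1 : A) - N) :=
    CStarAlgebra.isUnit_of_le (algebraMap ℝ A (T - r)) hle
      (h := ((isUnit_iff_ne_zero.2 hτ.ne').map (algebraMap ℝ A)).isStrictlyPositive hτ0)
  obtain ⟨u, hu⟩ := hu
  have h1 : (↑u⁻¹ : A) * (T • 1 - N) = 1 := by rw [← hu]; simp
  have h2 : (T • 1 - N) * (↑u⁻¹ : A) = 1 := by rw [← hu]; simp
  have hS : star (↑u⁻¹ : A) = ↑u⁻¹ := by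
    have h3 : star (↑u⁻¹ : A) * (T • 1 - N) = 1 := by
      have := congrArg star h2
      rwa [star_mul, hsa.star_eq, star_one] at this
    calc star (↑u⁻¹ : A) = star (↑u⁻¹ : A) * ((T • 1 - N) * (↑u⁻¹ : A)) := by rw [h2, mul_one]
      _ = ↑u⁻¹ := by rw [← mul_assoc, h3, one_mul]
  generalize (↑u⁻¹ : A) = S at *
  have hSN : S * N = T • S - 1 := by
    rw [mul_sub, mul_smul_comm, mul_one] at h1
    rw [← h1]; abel
  have hNS : N * S = T • S - 1 := by
    rw [sub_mul, smul_mul_assoc, one_mul] at h2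
    rw [← h2]; abel
  have hpos : ∀ X : A, 0 ≤ X → 0 ≤ S * X * S := fun X hX => by
    simpa [hS] using star_left_conjugate_nonneg hX S
  refine ⟨S, ?_, hSN, hNS, ?_⟩
  · have := hpos (T • 1 - N) (hτ0.trans hle)
    rwa [h1, one_mul] at this
  · have hY : 0 ≤ r • (1 : A) - N := sub_nonneg.2 hr
    have hYs : star (r • (1 : A) - N) = r • (1 : A) - N := (IsSelfAdjoint.of_nonneg hY).star_eq
    have hY2 : 0 ≤ (r • (1 : A) - N) * (r • (1 : A) - N) := by
      simpa [hYs] using star_mul_self_nonneg (r • (1 : A) - N)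
    have := add_nonneg (hpos _ hY2) (smul_nonneg hτ.le (hpos _ hY))
    rw [← sub_nonneg]
    convert this using 1
    simp only [mul_sub, sub_mul, smul_mul_assoc, mul_smul_comm, one_mul, mul_one, mul_assoc, hSN, hNS, smul_sub]
    module

/-- Completing squares: the difference of the two sides is the sum of the nonnegative terms `h1`,
`h2`, `h3`. -/
theorem row_contraction_apply {a b R Q : A} {r : ℝ} (hr : 0 < r) (hR : 0 ≤ R) (hQ : 0 ≤ Q)
    (hRQ : R * Q = 1) (hQR : Q * R = 1)
    (h : r • (a * R * star a) + b * star b ≤ r • (1 : A)) (α β : A) :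
    star (a * α + b * β) * (a * α + b * β) ≤ star α * Q * α + r • (star β * β) := by
  have hRs : star R = R := (IsSelfAdjoint.of_nonneg hR).star_eq
  have hQs : star Q = Q := (IsSelfAdjoint.of_nonneg hQ).star_eq
  set γ := a * α + b * β with hγ
  have h1 := star_left_conjugate_nonneg hQ (α - R * star a * γ)
  have h2 := smul_nonneg hr.le (star_mul_self_nonneg (β - r⁻¹ • (star b * γ)))
  have h3 := smul_nonneg (inv_nonneg.2 hr.le) (star_left_conjugate_nonneg (sub_nonneg.2 h) γ)
  have key := add_nonneg (add_nonneg h1 h2) h3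
  rw [← sub_nonneg]
  convert key using 1
  have e1 : star γ * γ = star γ * (a * α) + star γ * (b * β) := by rw [hγ, mul_add]
  have e2 : star γ * γ = star α * (star a * γ) + star β * (star b * γ) := by
    rw [hγ, star_add, star_mul, star_mul, add_mul, mul_assoc, mul_assoc]
  have hRQ' : ∀ x, R * (Q * x) = x := fun x => by rw [← mul_assoc, hRQ, one_mul]
  have hQR' : ∀ x, Q * (R * x) = x := fun x => by rw [← mul_assoc, hQR, one_mul]
  have e3 : star γ * γ + star γ * γ = star γ * (a * α) + star γ * (b * β) +
      (star α * (star a * γ) + star β * (star b * γ)) := by rw [← e1, ← e2]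
  have e4 : star γ * γ = star γ * (a * α) + star γ * (b * β) +
      (star α * (star a * γ) + star β * (star b * γ)) - star γ * γ := by rw [← e3]; abel
  clear_value γ
  simp only [mul_sub, sub_mul, mul_add, add_mul, star_sub, star_mul, star_smul, star_trivial,
    star_star, smul_mul_assoc, mul_smul_comm, mul_one, mul_assoc, hRs, hRQ', hQR',
    smul_sub, smul_add, smul_smul]
  nth_rw 1 [e4]
  match_scalars <;> field_simp <;> ring

theorem norm_le_of_star_mul_self_le {w : A} {q : ℝ} (hq : 0 ≤ q) (h : star w * w ≤ q • (1 : A)) :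
    ‖w‖ ≤ √q := by
  apply Real.le_sqrt_of_sq_le
  rw [sq, ← CStarRing.norm_star_mul_self]
  rw [← Algebra.algebraMap_eq_smul_one] at h
  exact (CStarAlgebra.norm_le_iff_le_algebraMap _ hq (star_mul_self_nonneg w)).2 h

theorem star_mul_self_le_of_norm_sq_le {w : A} {q : ℝ} (h : ‖w‖ ^ 2 ≤ q) :
    star w * w ≤ q • (1 : A) := by
  rw [← Algebra.algebraMap_eq_smul_one]
  exact CStarAlgebra.star_mul_le_algebraMap_norm_sq.trans (algebraMap_mono A h)

theorem smul_resolvent_conjugate_le {a b c R : A} {T : ℝ} (hR : star R = R)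
    (hRN : R * (star c * c) = T • R - 1) (hNR : (star c * c) * R = T • R - 1)
    (H : ∀ β : A, star (star a + star c * β) * (star a + star c * β) + b * star b ≤
      T • (1 + star β * β)) :
    T • (a * R * star a) ≤ T • 1 - b * star b := by
  -- This `β` is the critical point of `|a⋆ + c⋆β|² - T|β|²`, so `H` becomes a Schur complement
  -- bound.
  have h := H (c * R * star a)
  have e1 : star a + star c * (c * R * star a) = T • (R * star a) := by
    have : star c * (c * R * star a) = (star c * c) * R * star a := by simp only [mul_assoc]
    rw [this, hNR, sub_mul, one_mul, smul_mul_assoc]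
    abel
  have e2 : star (c * R * star a) * (c * R * star a) =
      T • (a * R * R * star a) - a * R * star a := by
    have : star (c * R * star a) * (c * R * star a) = a * (R * (star c * c)) * R * star a := by
      simp only [star_mul, star_star, hR, mul_assoc]
    rw [this, hRN]
    simp only [mul_sub, sub_mul, mul_smul_comm, smul_mul_assoc, mul_one]
  rw [e1, e2] at h
  rw [← sub_nonneg] at h ⊢
  convert h using 1
  simp only [star_smul, star_mul, star_star, hR, star_trivial, smul_mul_assoc, mul_smul_comm,
    mul_assoc]
  module

/-- `H` bounds the adjoint of the matrix `(a b; c 0)` by `√T` on columns `(1, β)`. Damping `a` to `g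
a h`, with `g = 1 - τS` and `h = 1 - τR`, lowers the bound to `√r`. The form `a u + v a h` keeps the
correction in any two-sided ideal containing `a`. -/
theorem exists_corner_correction {a b c : A} {ρ r T : ℝ} (hρ : 0 ≤ ρ) (hρr : ρ < r) (hrT : r < T)
    (hc : star c * c ≤ ρ • (1 : A)) (hb : b * star b ≤ ρ • (1 : A))
    (H : ∀ β : A, star (star a + star c * β) * (star a + star c * β) + b * star b ≤
      T • (1 + star β * β)) :
    ∃ u v h : A, ‖a * u + v * a * h‖ ≤ 2 * √(T - r) ∧ ∀ α β : A,
      star ((a - (a * u + v * a * h)) * α + b * β) * ((a - (a * u + v * a * h)) * α + b * β) +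
        star (c * α) * (c * α) ≤ r • (star α * α + star β * β) := by
  have hr : 0 < r := hρ.trans_lt hρr
  have hT : 0 < T := hr.trans hrT
  set τ := T - r with hτ_def
  have hτ : 0 < τ := sub_pos.2 hrT
  have hρr1 : ρ • (1 : A) ≤ r • (1 : A) := smul_le_smul_of_nonneg_right hρr.le zero_le_one
  have hNsa := IsSelfAdjoint.star_mul_self c
  have hMsa := IsSelfAdjoint.mul_star_self b
  have hM0 := mul_star_self_nonneg b
  obtain ⟨R, hR0, hRN, hNR, hR1⟩ := exists_resolvent hNsa (hc.trans hρr1) hrT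
  obtain ⟨R', hR'0, hR'N, hNR', -⟩ := exists_resolvent hNsa hc hρr
  obtain ⟨S, hS0, hSM, hMS, hS1⟩ := exists_resolvent hMsa (hb.trans hρr1) hrT
  have hRs : star R = R := (IsSelfAdjoint.of_nonneg hR0).star_eq
  have hSs : star S = S := (IsSelfAdjoint.of_nonneg hS0).star_eq
  have hA := smul_resolvent_conjugate_le hRs hRN hNR H
  have hA1 : a * R * star a ≤ 1 := by
    have h1 : T • (a * R * star a) ≤ T • (1 : A) := hA.trans (sub_le_self _ hM0)
    exact (smul_le_smul_iff_of_pos_left hT).1 h1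
  set N := star c * c with hN_def
  set M := b * star b with hM_def
  set h : A := 1 - τ • R with hh
  set g : A := 1 - τ • S with hg
  have hhs : star h = h := by simp [hh, hRs]
  have hgs : star g = g := by simp [hg, hSs]
  have hh0 : 0 ≤ h := sub_nonneg.2 hR1
  have hg0 : 0 ≤ g := sub_nonneg.2 hS1
  have hh1 : ‖h‖ ≤ 1 := by
    rw [CStarAlgebra.norm_le_one_iff_of_nonneg h hh0]
    exact sub_le_self _ (smul_nonneg hτ.le hR0)
  -- As `h = (r - N)R`, the factor `h` trades the resolvent at `r` for the one at `T`; `g` plays the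
  -- same role for `M` in `hgM`.
  have hhR : h * R' * h = R - τ • (R * R) := by
    have e1 : h = (r • 1 - N) * R := by
      rw [hh, sub_mul, hNR, smul_mul_assoc, one_mul, hτ_def]; module
    have e2 : R' * (r • 1 - N) = 1 := by
      rw [mul_sub, hR'N, mul_smul_comm, mul_one]; abel
    nth_rw 2 [e1]
    rw [← mul_assoc, mul_assoc h, e2, mul_one, hh, sub_mul, one_mul, smul_mul_assoc]
  have hRR : τ • (R * R) ≤ R := by
    rw [← sub_nonneg, ← hhR]
    simpa [hhs] using star_left_conjugate_nonneg hR'0 h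
  have hhR1 : h * R' * h ≤ R := by
    rw [hhR]
    refine sub_le_self _ (smul_nonneg hτ.le ?_)
    simpa [hRs] using star_mul_self_nonneg R
  have hTM : 0 ≤ T • (1 : A) - M :=
    sub_nonneg.2 (hb.trans (hρr1.trans (smul_le_smul_of_nonneg_right hrT.le zero_le_one)))
  have hgM : g * (T • 1 - M) * g = r • 1 - M - τ • g := by
    have e1 : (T • 1 - M) * g = r • 1 - M := by
      simp only [hg, hτ_def, mul_sub, sub_mul, mul_smul_comm, smul_mul_assoc, one_mul, mul_one, hMS]
      module
    rw [mul_assoc, e1]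
    simp only [hg, hτ_def, mul_sub, sub_mul, mul_smul_comm, smul_mul_assoc, one_mul, mul_one, hSM]
    module
  have hrow : r • ((g * a * h) * R' * star (g * a * h)) + M ≤ r • (1 : A) := by
    have e1 : (g * a * h) * R' * star (g * a * h) = g * (a * (h * R' * h) * star a) * g := by
      simp only [star_mul, hgs, hhs, mul_assoc]
    have i1 : g * (a * (h * R' * h) * star a) * g ≤ g * (a * R * star a) * g := by
      have := star_left_conjugate_le_conjugate (star_right_conjugate_le_conjugate hhR1 a) g
      rwa [hgs] at this
    have i2 : T • (g * (a * R * star a) * g) ≤ r • 1 - M := by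
      have := star_left_conjugate_le_conjugate hA g
      rw [hgs, hgM, mul_smul_comm, smul_mul_assoc] at this
      exact this.trans (sub_le_self _ (smul_nonneg hτ.le hg0))
    have i3 : 0 ≤ g * (a * R * star a) * g := by
      have := star_left_conjugate_nonneg (star_right_conjugate_nonneg hR0 a) g
      rwa [hgs] at this
    rw [e1, ← le_sub_iff_add_le]
    exact (smul_le_smul_of_nonneg_left i1 hr.le).trans
      ((smul_le_smul_of_nonneg_right hrT.le i3).trans i2)
  have hw : a - (a * (τ • R) + τ • S * a * h) = g * a * h := by
    simp only [hg, hh, mul_sub, sub_mul, mul_one, one_mul]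
    abel
  refine ⟨τ • R, τ • S, h, ?_, fun α β => ?_⟩
  · have n1 : ‖a * τ • R‖ ≤ √τ := by
      rw [← norm_star]
      refine norm_le_of_star_mul_self_le hτ.le ?_
      have e1 : star (star (a * τ • R)) * star (a * τ • R) =
          τ • (a * (τ • (R * R)) * star a) := by
        simp only [star_mul, star_smul, star_trivial, star_star, hRs, mul_smul_comm,
          smul_mul_assoc, mul_assoc]
      rw [e1]
      exact smul_le_smul_of_nonneg_left
        ((star_right_conjugate_le_conjugate hRR a).trans hA1) hτ.le
    have n2 : ‖τ • S * a‖ ≤ √τ := by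
      rw [← norm_star]
      refine norm_le_of_star_mul_self_le hτ.le ?_
      have e1 : star (star (τ • S * a)) * star (τ • S * a) =
          τ • (τ • (S * (a * star a) * S)) := by
        simp only [star_mul, star_smul, star_trivial, star_star, hSs, mul_smul_comm,
          smul_mul_assoc, mul_assoc]
      have i1 : a * star a ≤ T • 1 - M := by
        have := H 0
        rw [le_sub_iff_add_le]
        simpa using this
      have i2 : S * (a * star a) * S ≤ S := by
        have := star_left_conjugate_le_conjugate i1 S
        rw [hSs] at this
        refine this.trans (le_of_eq ?_)
        rw [mul_sub, hSM, mul_smul_comm, mul_one, sub_sub_cancel, one_mul]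
      rw [e1]
      exact smul_le_smul_of_nonneg_left ((smul_le_smul_of_nonneg_left i2 hτ.le).trans hS1) hτ.le
    calc ‖a * τ • R + τ • S * a * h‖ ≤ ‖a * τ • R‖ + ‖τ • S * a‖ * ‖h‖ :=
          (norm_add_le _ _).trans (by gcongr; exact norm_mul_le _ _)
      _ ≤ √τ + √τ * 1 := by gcongr
      _ = 2 * √τ := by ring
  · rw [hw]
    have e1 : R' * (r • 1 - N) = 1 := by
      rw [mul_sub, hR'N, mul_smul_comm, mul_one]; abel
    have e2 : (r • 1 - N) * R' = 1 := by
      rw [sub_mul, hNR', smul_mul_assoc, one_mul]; abel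
    have := row_contraction_apply hr hR'0 (sub_nonneg.2 (hc.trans hρr1)) e1 e2 hrow α β
    rw [← le_sub_iff_add_le]
    refine this.trans (le_of_eq ?_)
    simp only [hN_def, mul_sub, sub_mul, star_mul, mul_smul_comm, smul_mul_assoc, mul_one,
      mul_assoc]
    module

/-! ### Splitting an element by `k² + s² = 1` -/

theorem star_sub_mul_sub_le (p e : A) {θ : ℝ} (hθ : 0 < θ) :
    star (p - e) * (p - e) ≤ (1 + θ) • (star p * p) + (1 + θ⁻¹) • (star e * e) := by
  rw [← sub_nonneg]
  convert smul_nonneg hθ.le (star_mul_self_nonneg (p + θ⁻¹ • e)) using 1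
  simp only [mul_sub, sub_mul, mul_add, add_mul, star_sub, star_add, star_smul, star_trivial,
    smul_mul_assoc, mul_smul_comm]
  match_scalars <;> field_simp <;> ring

theorem star_mul_self_add_le {k s : A} (hk : IsSelfAdjoint k) (hs : IsSelfAdjoint s)
    (hks : k * s = s * k) (h1 : k * k + s * s = 1) (α β : A) :
    star (k * α + s * β) * (k * α + s * β) ≤ star α * α + star β * β := by
  rw [← sub_nonneg]
  -- `(α, β) ↦ (kα + sβ, sα - kβ)` is a unitary reflection.
  convert star_mul_self_nonneg (s * α - k * β) using 1
  have hss : s * s = 1 - k * k := by rw [← h1]; abel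
  have hss' : ∀ x, s * (s * x) = x - k * (k * x) := fun x => by
    rw [← mul_assoc, hss, sub_mul, one_mul, mul_assoc]
  have hks' : ∀ x, k * (s * x) = s * (k * x) := fun x => by rw [← mul_assoc, hks, mul_assoc]
  simp only [mul_sub, sub_mul, mul_add, add_mul, star_sub, star_add, star_mul, hk.star_eq,
    hs.star_eq, mul_assoc, hss', hks']
  abel

/-- Replacing the corner `sxs` by zero costs only a weighted Young inequality with weight `θ`. -/
theorem corner_row_bound {x k s : A} (hk : IsSelfAdjoint k) (hs : IsSelfAdjoint s)
    (hks : k * s = s * k) (h1 : k * k + s * s = 1) {θ η T : ℝ} (hθ : 0 < θ)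
    (hd : ‖s * x * s‖ ≤ η) (hT : (1 + θ) * ‖x‖ ^ 2 + (1 + θ⁻¹) * η ^ 2 ≤ T) (β : A) :
    star (star (k * x * k) + star (s * x * k) * β) * (star (k * x * k) + star (s * x * k) * β) +
      (k * x * s) * star (k * x * s) ≤ T • (1 + star β * β) := by
  set v := k + s * β with hv
  set w := star x * v with hw
  have hvv : star v * v ≤ 1 + star β * β := by
    simpa only [mul_one, star_one, hv] using star_mul_self_add_le hk hs hks h1 1 β
  have e1 : star (k * x * k) + star (s * x * k) * β = k * w := by
    simp only [star_mul, hk.star_eq, hs.star_eq, hw, hv, mul_add, mul_assoc]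
  have e2 : k * x * s = star (s * w - star (s * x * s) * β) := by
    simp only [star_mul, star_sub, star_add, star_star, hk.star_eq, hs.star_eq, hw, hv, mul_add,
      mul_assoc]
    abel
  have e3 : star (k * w) * (k * w) + star (s * w) * (s * w) = star w * w := by
    have : star (k * w) * (k * w) + star (s * w) * (s * w) = star w * (k * k + s * s) * w := by
      simp only [star_mul, hk.star_eq, hs.star_eq, mul_add, add_mul, mul_assoc]
    rw [this, h1, mul_one]
  have i1 : star w * w ≤ ‖x‖ ^ 2 • (1 + star β * β) := by
    have := star_left_conjugate_le_conjugate
      (star_mul_self_le_of_norm_sq_le (w := star x) (q := ‖x‖ ^ 2) (by rw [norm_star])) v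
    calc star w * w = star v * (star (star x) * star x) * v := by
          simp only [hw, star_mul, mul_assoc]
      _ ≤ _ := this
      _ = ‖x‖ ^ 2 • (star v * v) := by simp only [mul_smul_comm, smul_mul_assoc, mul_one]
      _ ≤ _ := smul_le_smul_of_nonneg_left hvv (sq_nonneg _)
  have i2 : star (star (s * x * s) * β) * (star (s * x * s) * β) ≤ η ^ 2 • (1 + star β * β) := by
    have := star_left_conjugate_le_conjugate
      (star_mul_self_le_of_norm_sq_le (w := star (s * x * s)) (q := η ^ 2)
        (by rw [norm_star]; gcongr)) β
    calc _ = star β * (star (star (s * x * s)) * star (s * x * s)) * β := by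
          simp only [star_mul, mul_assoc]
      _ ≤ _ := this
      _ = η ^ 2 • (star β * β) := by simp only [mul_smul_comm, smul_mul_assoc, mul_one]
      _ ≤ _ := smul_le_smul_of_nonneg_left (le_add_of_nonneg_left zero_le_one) (sq_nonneg _)
  have hpos : (0 : A) ≤ 1 + star β * β := add_nonneg zero_le_one (star_mul_self_nonneg β)
  rw [e1, e2, star_star]
  calc _ ≤ star (k * w) * (k * w) + ((1 + θ) • (star (s * w) * (s * w)) +
        (1 + θ⁻¹) • (star (star (s * x * s) * β) * (star (s * x * s) * β))) := by
        gcongr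
        exact star_sub_mul_sub_le _ _ hθ
    _ ≤ (1 + θ) • (star (k * w) * (k * w)) + ((1 + θ) • (star (s * w) * (s * w)) +
        (1 + θ⁻¹) • (star (star (s * x * s) * β) * (star (s * x * s) * β))) := by
        gcongr
        rw [add_smul, one_smul]
        exact le_add_of_nonneg_right (smul_nonneg hθ.le (star_mul_self_nonneg _))
    _ = (1 + θ) • (star w * w) +
        (1 + θ⁻¹) • (star (star (s * x * s) * β) * (star (s * x * s) * β)) := by
        rw [← add_assoc, ← smul_add, e3]
    _ ≤ (1 + θ) • (‖x‖ ^ 2 • (1 + star β * β)) + (1 + θ⁻¹) • (η ^ 2 • (1 + star β * β)) := by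
        exact add_le_add (smul_le_smul_of_nonneg_left i1 (by positivity))
          (smul_le_smul_of_nonneg_left i2 (by positivity))
    _ = ((1 + θ) * ‖x‖ ^ 2 + (1 + θ⁻¹) * η ^ 2) • (1 + star β * β) := by
        rw [smul_smul, smul_smul, ← add_smul]
    _ ≤ _ := smul_le_smul_of_nonneg_right hT hpos

theorem norm_le_one_of_mul_self_add_mul_self {k s : A} (hk : IsSelfAdjoint k)
    (hs : IsSelfAdjoint s) (h1 : k * k + s * s = 1) : ‖s‖ ≤ 1 := by
  have : star s * s ≤ (1 : ℝ) • (1 : A) := by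
    rw [one_smul, ← h1, hs.star_eq]
    refine le_add_of_nonneg_left ?_
    simpa [hk.star_eq] using star_mul_self_nonneg k
  simpa using norm_le_of_star_mul_self_le zero_le_one this

/-- `x` is recovered from its matrix by the row `(k, s)` and the column `(k, s)`, both contractive;
`sxs` is estimated separately. -/
theorem norm_sub_conjugate_le {x k s w : A} (hk : IsSelfAdjoint k) (hs : IsSelfAdjoint s)
    (hks : k * s = s * k) (h1 : k * k + s * s = 1) {r : ℝ} (hr : 0 ≤ r)
    (h : ∀ α β : A, star ((k * x * k - w) * α + k * x * s * β) *
        ((k * x * k - w) * α + k * x * s * β) +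
      star (s * x * k * α) * (s * x * k * α) ≤ r • (star α * α + star β * β)) :
    ‖x - k * w * k‖ ≤ √r + ‖s * x * s‖ := by
  have hs1 := norm_le_one_of_mul_self_add_mul_self hk hs h1
  set p := (k * x * k - w) * k + k * x * s * s with hp
  have e : x - k * w * k = (k * p + s * (s * x * k * k)) + s * (s * x * s) * s := by
    have : x = (k * k + s * s) * x * (k * k + s * s) := by rw [h1, one_mul, mul_one]
    nth_rw 1 [this]
    simp only [hp, mul_add, add_mul, mul_sub, sub_mul, mul_assoc]
    abel
  rw [e]
  refine (norm_add_le _ _).trans (add_le_add ?_ ?_)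
  · refine norm_le_of_star_mul_self_le hr ((star_mul_self_add_le hk hs hks h1 _ _).trans ?_)
    have := h k s
    rwa [hk.star_eq, hs.star_eq, h1] at this
  · calc ‖s * (s * x * s) * s‖ ≤ ‖s‖ * ‖s * x * s‖ * ‖s‖ :=
          (norm_mul_le _ _).trans (by gcongr; exact norm_mul_le _ _)
      _ ≤ 1 * ‖s * x * s‖ * 1 := by gcongr
      _ = _ := by ring

theorem exists_corner_correction_norm_lt {x : A} {q ε : ℝ} (hq : 0 ≤ q) (hε : 0 < ε)
    (hx : ‖x‖ ^ 2 < q + ε) :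
    ∃ η > 0, ∀ k s : A, IsSelfAdjoint k → IsSelfAdjoint s → k * s = s * k → k * k + s * s = 1 →
      ‖k * x * s‖ ^ 2 ≤ q + ε / 8 → ‖s * x * k‖ ^ 2 ≤ q + ε / 8 → ‖s * x * s‖ ≤ η →
      ∃ u v h : A, ‖k * x * k * u + v * (k * x * k) * h‖ ≤ 2 * √ε ∧
        ‖x - k * (k * x * k * u + v * (k * x * k) * h) * k‖ ^ 2 < q + ε / 2 := by
  have hr : √(q + ε / 4) < √(q + ε / 2) := Real.sqrt_lt_sqrt (by positivity) (by linarith)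
  set θ := (q + ε - ‖x‖ ^ 2) / (‖x‖ ^ 2 + 1) with hθ_def
  have hθ : 0 < θ := div_pos (by linarith) (by positivity)
  have hθx : (1 + θ) * ‖x‖ ^ 2 + θ = q + ε := by
    rw [hθ_def]; field_simp; ring
  -- The first bound on `η` keeps the Young error below `θ`; the second leaves room for `√(q + ε/4)
  -- + η < √(q + ε/2)`.
  refine ⟨min (θ / (1 + θ)) ((√(q + ε / 2) - √(q + ε / 4)) / 2), lt_min (by positivity)
    (by linarith), fun k s hk hs hks h1 hb hc hd => ?_⟩
  have hd1 := hd.trans (min_le_left _ _)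
  have hd2 := hd.trans (min_le_right _ _)
  have hθη : (1 + θ⁻¹) * (θ / (1 + θ)) ^ 2 ≤ θ := by
    have : (1 + θ⁻¹) * (θ / (1 + θ)) ^ 2 = θ / (1 + θ) := by field_simp; ring
    rw [this]
    exact div_le_self hθ.le (by linarith)
  have H := corner_row_bound hk hs hks h1 hθ hd1
    (T := q + ε) (by linarith)
  have hb' : k * x * s * star (k * x * s) ≤ (q + ε / 8) • (1 : A) := by
    simpa using star_mul_self_le_of_norm_sq_le (w := star (k * x * s)) (by rwa [norm_star])
  obtain ⟨u, v, h, hw, hwr⟩ := exists_corner_correction (r := q + ε / 4) (by positivity)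
    (by linarith) (by linarith) (star_mul_self_le_of_norm_sq_le hc) hb' H
  refine ⟨u, v, h, hw.trans ?_, ?_⟩
  · gcongr
    linarith
  · have := norm_sub_conjugate_le hk hs hks h1 (by positivity) hwr
    rw [← Real.lt_sqrt (norm_nonneg _)]
    linarith

theorem exists_sqrt_one_sub_sq {k : A} (hk : IsSelfAdjoint k) (hk1 : ‖k‖ ≤ 1) :
    ∃ s : A, IsSelfAdjoint s ∧ k * s = s * k ∧ k * k + s * s = 1 := by
  have h0 : 0 ≤ 1 - k * k := by
    have := star_mul_self_le_of_norm_sq_le (w := k) (q := 1) (by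
      rw [sq]; exact mul_le_one₀ hk1 (norm_nonneg _) hk1)
    rw [hk.star_eq, one_smul] at this
    exact sub_nonneg.2 this
  refine ⟨CFC.sqrt (1 - k * k), .of_nonneg (CFC.sqrt_nonneg _), ?_, ?_⟩
  · have hc : Commute (1 - k * k) k :=
      (Commute.one_left k).sub_left ((Commute.refl k).mul_left (Commute.refl k))
    exact (hc.cfcₙ_nnreal NNReal.sqrt).symm.eq
  · rw [CFC.sqrt_mul_sqrt_self _ h0]; abel

end Unital

/-! ### Approximate units and heredity -/

section Hereditary

open Filter Topology

variable {B : Type*} [NonUnitalCStarAlgebra B]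

theorem exists_approximateUnit_filter {D : NonUnitalStarSubalgebra ℂ B}
    (hD : IsClosed (D : Set B)) :
    ∃ F : Filter B, F.NeBot ∧ (∀ᶠ k in F, k ∈ D ∧ IsSelfAdjoint k ∧ ‖k‖ ≤ 1) ∧
      ∀ d ∈ D, Tendsto (fun k => d * k) F (𝓝 d) := by
  have := hD
  let _ : PartialOrder D := CStarAlgebra.spectralOrder D
  have : StarOrderedRing D := CStarAlgebra.spectralOrderedRing D
  have hF := CStarAlgebra.increasingApproximateUnit D
  refine ⟨(CStarAlgebra.approximateUnit D).map (Subtype.val : D → B), inferInstance, ?_, ?_⟩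
  · rw [eventually_map]
    filter_upwards [hF.eventually_isSelfAdjoint, hF.eventually_norm] with k hk hk1
    exact ⟨k.2, congrArg Subtype.val hk.star_eq, hk1⟩
  · intro d hd
    rw [tendsto_map'_iff]
    exact (continuous_subtype_val.tendsto _).comp (hF.tendsto_mul_left ⟨d, hd⟩)

theorem tendsto_mul_of_mem_associatedLeftIdeal {D : NonUnitalStarSubalgebra ℂ B} {F : Filter B}
    (hF : ∀ᶠ k in F, ‖k‖ ≤ 1) (hFD : ∀ d ∈ D, Tendsto (fun k => d * k) F (𝓝 d)) {l : B}
    (hl : l ∈ associatedLeftIdeal D) : Tendsto (fun k => l * k) F (𝓝 l) := by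
  have hspan : ∀ y ∈ Submodule.span ℂ {x : B | ∃ b : B, ∃ d ∈ D, x = b * d},
      Tendsto (fun k => y * k) F (𝓝 y) := by
    intro y hy
    induction hy using Submodule.span_induction with
    | mem y hy =>
      obtain ⟨b, d, hd, rfl⟩ := hy
      simpa only [mul_assoc] using (hFD d hd).const_mul b
    | zero => simpa using tendsto_const_nhds
    | add y z _ _ hy hz => simpa only [add_mul] using hy.add hz
    | smul c y _ hy => simpa only [smul_mul_assoc] using hy.const_smul c
  rw [Metric.tendsto_nhds]
  intro ε hε
  obtain ⟨y, hy, hly⟩ := Metric.mem_closure_iff.1 hl (ε / 3) (by positivity)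
  filter_upwards [hF, Metric.tendsto_nhds.1 (hspan y hy) (ε / 3) (by positivity)] with k hk hyk
  rw [dist_eq_norm] at *
  calc ‖l * k - l‖ = ‖(l - y) * k + (y * k - y) - (l - y)‖ := by
        congr 1; rw [sub_mul]; abel
    _ ≤ ‖(l - y) * k‖ + ‖y * k - y‖ + ‖l - y‖ :=
        (norm_sub_le _ _).trans (by gcongr; exact norm_add_le _ _)
    _ ≤ ‖l - y‖ * ‖k‖ + ‖y * k - y‖ + ‖l - y‖ := by gcongr; exact norm_mul_le _ _
    _ ≤ ‖l - y‖ * 1 + ‖y * k - y‖ + ‖l - y‖ := by gcongr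
    _ < ε := by linarith

theorem le_associatedLeftIdeal {D : NonUnitalStarSubalgebra ℂ B} (hD : IsClosed (D : Set B)) :
    D.toNonUnitalSubalgebra.toSubmodule ≤ associatedLeftIdeal D := by
  intro d hd
  obtain ⟨F, hne, hF, hFD⟩ := exists_approximateUnit_filter hD
  refine mem_closure_of_tendsto (hFD d hd) ?_
  filter_upwards [hF] with k hk
  exact Submodule.subset_span ⟨d, k, hk.1, rfl⟩

theorem IsHereditarySubalgebra.conjugate_mem [PartialOrder B] [StarOrderedRing B]
    {D : NonUnitalStarSubalgebra ℂ B} (hD : IsHereditarySubalgebra D) {k : B} (hk : k ∈ D)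
    (hks : IsSelfAdjoint k) (b : B) : k * b * k ∈ D := by
  -- By linearity `b ≥ 0` may be assumed; then `0 ≤ kbk ≤ ‖b‖k²`.
  have hb : b ∈ Submodule.span ℂ {a : B | 0 ≤ a} := by
    rw [CStarAlgebra.span_nonneg]; trivial
  induction hb using Submodule.span_induction with
  | mem b hb =>
    have h1 := star_left_conjugate_nonneg (show (0 : B) ≤ b from hb) k
    have h2 := CStarAlgebra.star_left_conjugate_le_norm_smul (a := k) (b := b)
      (IsSelfAdjoint.of_nonneg hb)
    rw [hks.star_eq] at h1 h2
    refine hD.hereditary ?_ h1 h2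
    rw [RCLike.real_smul_eq_coe_smul (K := ℂ)]
    exact SMulMemClass.smul_mem _ (mul_mem hk hk)
  | zero => simp
  | add y z _ _ hy hz => simpa only [mul_add, add_mul] using add_mem hy hz
  | smul c y _ hy => simpa only [mul_smul_comm, smul_mul_assoc] using SMulMemClass.smul_mem c hy

/-! ### One correction step, in the unitization -/

section Unitization

open Unitization

theorem norm_inr_mul_sq_le {x k : B} {s : Unitization ℂ B} (hk1 : ‖k‖ ≤ 1)
    (hs : IsSelfAdjoint s) (h1 : (k : Unitization ℂ B) * k + s * s = 1) :
    ‖(x : Unitization ℂ B) * s‖ ^ 2 ≤ 2 * ‖x * k - x‖ * ‖x‖ := by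
  have hss : s * s = 1 - (k : Unitization ℂ B) * k := by rw [← h1]; abel
  -- Here `x(1 - k²) = (x - xk)(1 + k)`.
  have e : (x : Unitization ℂ B) * s * star ((x : Unitization ℂ B) * s) =
      ((-((x * k - x) + (x * k - x) * k) * star x : B) : Unitization ℂ B) := by
    rw [star_mul, hs.star_eq, mul_assoc, ← mul_assoc s, hss]
    simp only [inr_mul, inr_neg, inr_add, inr_sub, inr_star]
    noncomm_ring
  rw [sq, ← CStarRing.norm_self_mul_star, e, norm_inr]
  calc _ ≤ ‖-((x * k - x) + (x * k - x) * k)‖ * ‖star x‖ := norm_mul_le _ _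
    _ ≤ (‖x * k - x‖ + ‖x * k - x‖ * ‖k‖) * ‖x‖ := by
        rw [norm_neg, norm_star]
        gcongr
        exact (norm_add_le _ _).trans (by gcongr; exact norm_mul_le _ _)
    _ ≤ (‖x * k - x‖ + ‖x * k - x‖ * 1) * ‖x‖ := by gcongr
    _ = _ := by ring

theorem eventually_norm_inr_mul_lt {F : Filter B} (hF : ∀ᶠ k in F, ‖k‖ ≤ 1) {x : B}
    (hx : Tendsto (fun k => x * k) F (𝓝 x)) {δ : ℝ} (hδ : 0 < δ) :
    ∀ᶠ k : B in F, ∀ s : Unitization ℂ B, IsSelfAdjoint s →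
      (k : Unitization ℂ B) * k + s * s = 1 → ‖(x : Unitization ℂ B) * s‖ < δ := by
  have h : Tendsto (fun k => 2 * ‖x * k - x‖ * ‖x‖) F (𝓝 0) := by
    simpa using (((hx.sub_const x).norm).const_mul 2).mul_const ‖x‖
  filter_upwards [hF, h.eventually (gt_mem_nhds (pow_pos hδ 2))] with k hk hlt s hs h1
  exact lt_of_pow_lt_pow_left₀ 2 hδ.le ((norm_inr_mul_sq_le hk hs h1).trans_lt hlt)

theorem IsHereditarySubalgebra.exists_mem_norm_sub_sq_lt [PartialOrder B] [StarOrderedRing B]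
    {D : NonUnitalStarSubalgebra ℂ B}
    (hD : IsHereditarySubalgebra D) {x : B}
    (hxL : x ∈ associatedLeftIdeal D ⊔ adjointSubspace (associatedLeftIdeal D)) {q ε : ℝ}
    (hq : 0 ≤ q) (hε : 0 < ε) (hdist : ∀ δ > 0, ∃ z ∈ D, ‖x - z‖ ^ 2 < q + δ)
    (hx : ‖x‖ ^ 2 < q + ε) :
    ∃ y ∈ D, ‖y‖ ≤ 2 * √ε ∧ ‖x - y‖ ^ 2 < q + ε / 2 := by
  obtain ⟨l, hl, m, hm, rfl⟩ := Submodule.mem_sup.1 hxL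
  replace hm : star m ∈ associatedLeftIdeal D := hm
  set x := l + m with hx_def
  obtain ⟨z, hz, hxz⟩ := hdist (ε / 16) (by positivity)
  obtain ⟨F, hne, hF, hFD⟩ := exists_approximateUnit_filter hD.isClosed
  have hF1 : ∀ᶠ k in F, ‖k‖ ≤ 1 := hF.mono fun k hk => hk.2.2
  obtain ⟨η, hη, hstep⟩ := exists_corner_correction_norm_lt (x := (x : Unitization ℂ B)) hq hε
    (by rwa [norm_inr])
  have hδ : 0 < √(q + ε / 8) - ‖x - z‖ :=
    sub_pos.2 (Real.lt_sqrt_of_sq_lt (hxz.trans (by linarith)))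
  obtain ⟨k, ⟨hkD, hks, hk1⟩, hzk, hzk', hlk, hmk⟩ := (hF.and
    ((eventually_norm_inr_mul_lt hF1 (hFD z hz) hδ).and
    ((eventually_norm_inr_mul_lt hF1 (hFD _ (star_mem hz)) hδ).and
    ((eventually_norm_inr_mul_lt hF1 (tendsto_mul_of_mem_associatedLeftIdeal hF1 hFD hl)
      (half_pos hη)).and
    (eventually_norm_inr_mul_lt hF1 (tendsto_mul_of_mem_associatedLeftIdeal hF1 hFD hm)
      (half_pos hη)))))).exists
  have hkA : IsSelfAdjoint (k : Unitization ℂ B) := by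
    rw [isSelfAdjoint_iff, ← inr_star, hks.star_eq]
  have hkA1 : ‖(k : Unitization ℂ B)‖ ≤ 1 := by rwa [norm_inr]
  obtain ⟨s, hs, hcomm, h1⟩ := exists_sqrt_one_sub_sq hkA hkA1
  have hs1 := norm_le_one_of_mul_self_add_mul_self hkA hs h1
  have corner : ∀ x z : B, ‖(z : Unitization ℂ B) * s‖ < √(q + ε / 8) - ‖x - z‖ →
      ‖(x : Unitization ℂ B) * s‖ ≤ √(q + ε / 8) := by
    intro x z h
    have e : (x : Unitization ℂ B) * s = ((x - z : B) : Unitization ℂ B) * s + z * s := by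
      rw [inr_sub]; noncomm_ring
    have i1 : ‖((x - z : B) : Unitization ℂ B) * s‖ ≤ ‖x - z‖ * 1 :=
      (norm_mul_le _ _).trans (by rw [norm_inr]; gcongr)
    rw [e]
    linarith [norm_add_le (((x - z : B) : Unitization ℂ B) * s) (z * s)]
  have hxs := corner x z (hzk s hs h1)
  have hsx : ‖s * (x : Unitization ℂ B)‖ ≤ √(q + ε / 8) := by
    rw [← norm_star, star_mul, hs.star_eq, ← inr_star]
    refine corner (star x) (star z) ?_
    rw [← star_sub, norm_star]
    exact hzk' s hs h1
  have hb : ‖(k : Unitization ℂ B) * x * s‖ ^ 2 ≤ q + ε / 8 := by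
    rw [← Real.le_sqrt (norm_nonneg _) (by positivity), mul_assoc]
    calc _ ≤ ‖(k : Unitization ℂ B)‖ * ‖(x : Unitization ℂ B) * s‖ := norm_mul_le _ _
      _ ≤ 1 * √(q + ε / 8) := by gcongr
      _ = _ := one_mul _
  have hc : ‖s * (x : Unitization ℂ B) * k‖ ^ 2 ≤ q + ε / 8 := by
    rw [← Real.le_sqrt (norm_nonneg _) (by positivity)]
    calc _ ≤ ‖s * (x : Unitization ℂ B)‖ * ‖(k : Unitization ℂ B)‖ := norm_mul_le _ _
      _ ≤ √(q + ε / 8) * 1 := by gcongr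
      _ = _ := mul_one _
  have hd : ‖s * (x : Unitization ℂ B) * s‖ ≤ η := by
    have e : s * (x : Unitization ℂ B) * s =
        s * ((l : Unitization ℂ B) * s) + star (((star m : B) : Unitization ℂ B) * s) * s := by
      rw [hx_def, inr_add, star_mul, hs.star_eq, inr_star, star_star]; noncomm_ring
    rw [e]
    calc _ ≤ ‖s‖ * ‖(l : Unitization ℂ B) * s‖ +
          ‖star (((star m : B) : Unitization ℂ B) * s)‖ * ‖s‖ :=
          (norm_add_le _ _).trans (add_le_add (norm_mul_le _ _) (norm_mul_le _ _))
      _ ≤ 1 * (η / 2) + η / 2 * 1 := by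
          rw [norm_star]
          have := (hlk s hs h1).le
          have := (hmk s hs h1).le
          gcongr
      _ = η := by ring
  obtain ⟨u, v, h, hw, hwx⟩ := hstep k s hkA hs hcomm h1 hb hc hd
  set w := (k : Unitization ℂ B) * x * k * u + v * (k * x * k) * h with hw_def
  -- Each summand of `w` contains a factor from the ideal `B`, so `w` lies in `B` although `u`, `v`,
  -- `h` need not.
  have hw0 : w.fst = 0 := by simp [hw_def]
  obtain ⟨w', hw'⟩ : ∃ w' : B, w = w' := ⟨w.snd, by
    refine Unitization.ext ?_ ?_ <;> simp [hw0]⟩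
  rw [hw'] at hw hwx
  rw [norm_inr] at hw
  refine ⟨k * w' * k, hD.conjugate_mem hkD hks w', ?_, ?_⟩
  · calc ‖k * w' * k‖ ≤ ‖k‖ * ‖w'‖ * ‖k‖ := (norm_mul_le _ _).trans (by gcongr; exact norm_mul_le _ _)
      _ ≤ 1 * (2 * √ε) * 1 := by gcongr
      _ = _ := by ring
  · rwa [← inr_mul, ← inr_mul, ← inr_sub, norm_inr] at hwx

end Unitization

end Hereditary

/-! ### Iteration to a closest point -/

theorem theorem4p10 {B : Type*} [NonUnitalCStarAlgebra B] [PartialOrder B] [StarOrderedRing B]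
    (D : NonUnitalStarSubalgebra ℂ B) (hD : IsHereditarySubalgebra D) :
    IsProximinalIn D.toNonUnitalSubalgebra.toSubmodule
      (associatedLeftIdeal D ⊔ adjointSubspace (associatedLeftIdeal D)) := by
  have hDL := (le_associatedLeftIdeal hD.isClosed).trans
    (le_sup_left (b := adjointSubspace (associatedLeftIdeal D)))
  refine ⟨hDL, fun x hx => ?_⟩
  have hne : (D : Set B).Nonempty := ⟨0, D.zero_mem⟩
  set q := Metric.infDist x (D : Set B) ^ 2 with hq
  have hdist : ∀ δ > 0, ∃ z ∈ D, ‖x - z‖ ^ 2 < q + δ := by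
    intro δ hδ
    have : Metric.infDist x (D : Set B) < √(q + δ) := by
      apply Real.lt_sqrt_of_sq_lt
      linarith
    obtain ⟨z, hz, hxz⟩ := (Metric.infDist_lt_iff hne).1 this
    rw [dist_eq_norm, Real.lt_sqrt (norm_nonneg _)] at hxz
    exact ⟨z, hz, hxz⟩
  have step : ∀ (n : ℕ) (y : B), y ∈ D ∧ ‖x - y‖ ^ 2 < q + (1 / 2) ^ n →
      ∃ y' : B, (y' ∈ D ∧ ‖x - y'‖ ^ 2 < q + (1 / 2) ^ (n + 1)) ∧
        ‖y' - y‖ ≤ 2 * √(1 / 2) ^ n := by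
    rintro n y ⟨hy, hxy⟩
    obtain ⟨y', hy', hn, hlt⟩ := hD.exists_mem_norm_sub_sq_lt
      (Submodule.sub_mem _ hx (hDL hy)) (sq_nonneg _) (by positivity : (0 : ℝ) < (1 / 2) ^ n)
      (fun δ hδ => by
        obtain ⟨z, hz, hxz⟩ := hdist δ hδ
        exact ⟨z - y, sub_mem hz hy, by rwa [sub_sub_sub_cancel_right]⟩) hxy
    refine ⟨y + y', ⟨add_mem hy hy', ?_⟩, ?_⟩
    · rw [← sub_sub]
      refine hlt.trans_eq ?_
      rw [pow_succ]; ring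
    · rw [add_sub_cancel_left]
      refine hn.trans_eq ?_
      rw [Real.sqrt_eq_rpow, Real.sqrt_eq_rpow, ← Real.rpow_natCast, ← Real.rpow_natCast,
        ← Real.rpow_mul (by norm_num), ← Real.rpow_mul (by norm_num), mul_comm (n : ℝ)]
  choose! f hf hfd using step
  obtain ⟨y₀, hy₀, hxy₀⟩ := hdist 1 one_pos
  let Y : ℕ → B := fun n => Nat.rec y₀ f n
  have hY : ∀ n, Y n ∈ D ∧ ‖x - Y n‖ ^ 2 < q + (1 / 2) ^ n := by
    intro n
    induction n with
    | zero => exact ⟨hy₀, by rw [pow_zero]; exact hxy₀⟩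
    | succ n ih => exact hf n (Y n) ih
  have hcauchy : CauchySeq Y := by
    refine cauchySeq_of_le_geometric (√(1 / 2)) 2 ?_ fun n => ?_
    · rw [Real.sqrt_lt' one_pos]; norm_num
    · rw [dist_comm, dist_eq_norm]
      exact hfd n (Y n) (hY n)
  obtain ⟨y, hy⟩ := cauchySeq_tendsto_of_complete hcauchy
  refine ⟨y, hD.isClosed.mem_of_tendsto hy (.of_forall fun n => (hY n).1), fun z hz => ?_⟩
  have hle : ‖x - y‖ ^ 2 ≤ q := by
    have h1 : Filter.Tendsto (fun n => ‖x - Y n‖ ^ 2) Filter.atTop (nhds (‖x - y‖ ^ 2)) :=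
      ((hy.const_sub x).norm).pow 2
    have h2 : Filter.Tendsto (fun n : ℕ => q + (1 / 2 : ℝ) ^ n) Filter.atTop (nhds (q + 0)) :=
      (tendsto_pow_atTop_nhds_zero_of_lt_one (by norm_num) (by norm_num)).const_add q
    rw [add_zero] at h2
    exact le_of_tendsto_of_tendsto' h1 h2 fun n => (hY n).2.le
  calc ‖x - y‖ ≤ Metric.infDist x (D : Set B) :=
        abs_le_of_sq_le_sq' hle Metric.infDist_nonneg |>.2
    _ ≤ dist x z := Metric.infDist_le_dist_of_mem hz
    _ = ‖x - z‖ := dist_eq_norm _ _
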